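/- **Theorem 8.** For $D=1$, an integer $m$, $p\in\mathbb R^D$ and $0\neq q\in\mathbb R^m$ let $$I_{D,m}(p,q)=\int_{\mathbb R^m}\frac{d^mq'}{(2\pi)^m}\int_{\mathbb R^D}\frac{d^Dp'}{(2\pi)^D}\,\frac{1}{|p'|^2+|q'|^4}\,\frac{1}{|p'+p|^2+|q'+q|^4}.$$ For real $m>1$ the outer integral is understood, as usual, through rotational symmetry: for a function $f(r,\theta)$ of $r=|q'|$ and of the angle $\theta$ between $q'$ and $q$, $$\int\frac{d^mq'}{(2\pi)^m}f=K_m\int_0^\infty r^{m-1}\int_0^\pi\frac{\sin^{m-2}\theta}{\Omega_m}f(r,\theta)\,d\theta\,dr,\qquad K_m=\frac{2(4\pi)^{-m/2}}{\Gamma(m/2)},\quad \Omega_m=\frac{\sqrt\pi\,\Gamma(\frac{m-1}2)}{\Gamma(\frac m2)},$$ with $|q'+q|^2=r^2+2r|q|\cos\theta+|q|^2$. Then $I_{D,m}$ depends on $q$ only through $|q|>0$. Put $\epsilon=D-2+\frac m2$. The Horn function is $$H_4(\alpha,\beta;\gamma,\delta;x,y)=\sum_{n,k\ge0}\frac{(\alpha)_{2k+n}(\beta)_n}{(\gamma)_k(\delta)_n}\frac{x^k}{k!}\frac{y^n}{n!}\qquad(2\sqrt{|x|}+|y|<1).$$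 Let $D=1$ and $2<m<6$, so that $\epsilon=\frac m2-1\in(0,2)$, and let $4|p|^2/|q|^4<1$. Then the integral $I_{1,m}(p,q)$ and the series below converge absolutely, and $$I_{1,m}(p,q)=|q|^{-4+2\epsilon}\,\frac{2\,\Gamma(2-\epsilon)}{\epsilon\,(8\pi)^{1+\epsilon}}\;H_4\Big(2-\epsilon,\epsilon;\tfrac32,1+\epsilon;-\frac{|p|^2}{4|q|^4},\tfrac12\Big).$$ This holds for every real $m\in(2,6)$ with the integral in real dimension $m$, and for $m\in\{3,4,5\}$ with the integral over $\mathbb R\oplus\mathbb R^m$ itself. -/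

import Mathlib

noncomputable section

/-- The product of the two propagators `1 / (p'² + a²)` and `1 / (|p' + p|² + b²)` on `ℝ^D`.
In the Feynman integral, `a = |q'|²` and `b = |q' + q|²`. -/
def lifshitzPropagators (D : ℕ) (p p' : EuclideanSpace ℝ (Fin D)) (a b : ℝ) : ℝ :=
  1 / (‖p'‖ ^ 2 + a ^ 2) * (1 / (‖p' + p‖ ^ 2 + b ^ 2))

/-- The inner integral over `ℝ^D`, with measure `d^D p' / (2π)^D`. -/
def lifshitzInner (D : ℕ) (p : EuclideanSpace ℝ (Fin D)) (a b : ℝ) : ℝ :=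
  ∫ p' : EuclideanSpace ℝ (Fin D), lifshitzPropagators D p p' a b / (2 * Real.pi) ^ D

/-- The Feynman integral `I_{D,m}(p, q)` over `ℝ^D ⊕ ℝ^m`, for integer dimensions `D` and `m`. -/
def lifshitzIntegral (D m : ℕ) (p : EuclideanSpace ℝ (Fin D)) (q : EuclideanSpace ℝ (Fin m)) : ℝ :=
  ∫ q' : EuclideanSpace ℝ (Fin m),
    lifshitzInner D p (‖q'‖ ^ 2) (‖q' + q‖ ^ 2) / (2 * Real.pi) ^ m

/-- Absolute convergence of the Feynman integral over `ℝ^D ⊕ ℝ^m`. -/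
def LifshitzConverges (D m : ℕ) (p : EuclideanSpace ℝ (Fin D)) (q : EuclideanSpace ℝ (Fin m)) :
    Prop :=
  MeasureTheory.Integrable
    (fun x : EuclideanSpace ℝ (Fin D) × EuclideanSpace ℝ (Fin m) =>
      lifshitzPropagators D p x.1 (‖x.2‖ ^ 2) (‖x.2 + q‖ ^ 2))

/-- `K_m = S_m / (2π)^m`, where `S_m = 2 π^(m/2) / Γ(m/2)` is the area of the unit sphere in
`m` dimensions. -/
def sphereConst (m : ℝ) : ℝ := 2 * (4 * Real.pi) ^ (-m / 2) / Real.Gamma (m / 2)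

/-- `Ω_m = ∫_0^π sin^(m-2) θ dθ`, for `m > 1`. -/
def angularConst (m : ℝ) : ℝ :=
  Real.sqrt Real.pi * Real.Gamma (m / 2 - 1 / 2) / Real.Gamma (m / 2)

/-- `|q' + q|²` for vectors of lengths `r = |q'|` and `q` at an angle `θ`. -/
def shiftedSq (q r θ : ℝ) : ℝ := r ^ 2 + 2 * r * q * Real.cos θ + q ^ 2

/-- The Feynman integral `I_{D,m}(p, q)` for a real dimension `m > 1`: the integral
`∫ d^m q' / (2π)^m` of a function of `r = |q'|` and of the angle `θ` between `q'` and `q` is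
`K_m ∫_0^∞ r^(m-1) ∫_0^π (sin^(m-2) θ / Ω_m) (·) dθ dr`; here `q` is the length of the vector. -/
def lifshitzIntegralReal (D : ℕ) (m : ℝ) (p : EuclideanSpace ℝ (Fin D)) (q : ℝ) : ℝ :=
  sphereConst m *
    ∫ r in Set.Ioi (0 : ℝ), r ^ (m - 1) *
      ∫ θ in Set.Ioo 0 Real.pi, Real.sin θ ^ (m - 2) / angularConst m *
        lifshitzInner D p (r ^ 2) (shiftedSq q r θ)

/-- Absolute convergence of the Feynman integral for a real dimension `m`. -/
def LifshitzConvergesReal (D : ℕ) (m : ℝ) (p : EuclideanSpace ℝ (Fin D)) (q : ℝ) : Prop :=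
  MeasureTheory.IntegrableOn
    (fun x : EuclideanSpace ℝ (Fin D) × ℝ × ℝ =>
      x.2.1 ^ (m - 1) * Real.sin x.2.2 ^ (m - 2) *
        lifshitzPropagators D p x.1 (x.2.1 ^ 2) (shiftedSq q x.2.1 x.2.2))
    (Set.univ ×ˢ Set.Ioi (0 : ℝ) ×ˢ Set.Ioo 0 Real.pi)

/-- `ε = D - 2 + m/2`. -/
def lifshitzEps (D : ℕ) (m : ℝ) : ℝ := D - 2 + m / 2

/-- The Pochhammer symbol `(a)_n = a (a+1) ⋯ (a+n-1)`. -/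
def poch (a : ℝ) (n : ℕ) : ℝ := (ascPochhammer ℝ n).eval a

/-- The term of index `(n, k)` of the double series of the Horn function `H₄`. -/
def hornH4Term (α β γ δ x y : ℝ) (nk : ℕ × ℕ) : ℝ :=
  poch α (2 * nk.2 + nk.1) * poch β nk.1 / (poch γ nk.2 * poch δ nk.1) *
    (x ^ nk.2 / (nk.2.factorial : ℝ)) * (y ^ nk.1 / (nk.1.factorial : ℝ))

/-- The Horn function `H₄(α, β; γ, δ; x, y)`, as an (absolutely convergent) double series. -/
def hornH4 (α β γ δ x y : ℝ) : ℝ := ∑' nk : ℕ × ℕ, hornH4Term α β γ δ x y nk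

end

/-! ### The one-dimensional inner integral in closed form. -/

section CauchyConvolution

open MeasureTheory Real Set Filter Topology

/-! With a = |q'|², b = |q' + q|² and P = |p|, the inner integral is a convolution of Cauchy
profiles, equal to (a + b) / (2ab((a + b)² + P²)) (`integral_cauchy_mul_cauchy`). Since a + b ≥
|q|²/2, the hypothesis 4P²/|q|⁴ < 1 is what makes its geometric expansion in -P²/(a + b)² converge,
and there remain the moments ∫ 1 / (2ab(a + b)^n) with n = 2k + 1.

Splitting 1/(ab) = (1/a + 1/b)/(a + b) reduces a moment to ∫ 1 / (a(a + b)^(n+1)) and its mirror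
image. A Feynman parameter w ∈ (0, 1/2) and a Schwinger parameter t turn this into an integral of
exp(-Aa - Bb), so only the joint Laplace transform of (a, b) matters (`HasGaussianLaw`). That
transform has the same form for Lebesgue measure on ℝ^m and for the zonal measure in real dimension
m, which lets one argument serve both halves of the theorem.

The t-integral gives Γ(n + 1 - ε) and leaves an incomplete beta integral over (0, 1/2), whose
binomial expansion supplies the second summation and the argument 1/2 of H₄
(`const_mul_hornH4Term`). Before the sign of -P² enters, everything is nonnegative: Tonelli
justifies the interchanges, and convergence follows from finiteness. -/

lemma integrable_one_div_sq_add_sq {a : ℝ} (ha : 0 < a) :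
    Integrable (fun x : ℝ => 1 / (x ^ 2 + a ^ 2)) := by
  have h := (integrable_inv_one_add_sq.comp_div ha.ne').const_mul (1 / a ^ 2)
  refine h.congr (Eventually.of_forall fun x => ?_)
  have : x ^ 2 + a ^ 2 ≠ 0 := by positivity
  have h2 : a ^ 2 + x ^ 2 ≠ 0 := by positivity
  simp only
  field_simp
  ring

lemma integrable_cauchy_mul_cauchy {a b : ℝ} (ha : 0 < a) (hb : 0 < b) (p : ℝ) :
    Integrable (fun x : ℝ => 1 / (x ^ 2 + a ^ 2) * (1 / ((x + p) ^ 2 + b ^ 2))) := by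
  have hm : Measurable (fun x : ℝ => 1 / ((x + p) ^ 2 + b ^ 2)) := by fun_prop
  refine (integrable_one_div_sq_add_sq ha).mul_bdd (c := 1 / b ^ 2) hm.aestronglyMeasurable
    (Eventually.of_forall fun x => ?_)
  rw [Real.norm_of_nonneg (by positivity)]
  gcongr
  nlinarith [sq_nonneg (x + p)]

lemma hasDerivAt_arctan_div {c : ℝ} (hc : c ≠ 0) (p x : ℝ) :
    HasDerivAt (fun x => arctan ((x + p) / c)) (c / ((x + p) ^ 2 + c ^ 2)) x := by
  have h := (((hasDerivAt_id x).add_const p).div_const c).arctan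
  refine h.congr_deriv ?_
  have : (x + p) ^ 2 + c ^ 2 ≠ 0 := by positivity
  have : c ^ 2 + (x + p) ^ 2 ≠ 0 := by positivity
  simp only [id_eq]
  field_simp
  ring

lemma tendsto_arctan_div_atTop {c : ℝ} (hc : 0 < c) (p : ℝ) :
    Tendsto (fun x => arctan ((x + p) / c)) atTop (𝓝 (π / 2)) :=
  (tendsto_nhds_of_tendsto_nhdsWithin tendsto_arctan_atTop).comp
    ((tendsto_atTop_add_const_right _ p tendsto_id).atTop_div_const hc)

lemma tendsto_arctan_div_atBot {c : ℝ} (hc : 0 < c) (p : ℝ) :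
    Tendsto (fun x => arctan ((x + p) / c)) atBot (𝓝 (-(π / 2))) :=
  (tendsto_nhds_of_tendsto_nhdsWithin tendsto_arctan_atBot).comp
    ((tendsto_atBot_add_const_right _ p tendsto_id).atBot_div_const hc)

lemma tendsto_sq_add_sq_div {l : Filter ℝ} (hl : Tendsto (fun x : ℝ => x⁻¹) l (𝓝 0))
    (hne : ∀ᶠ x in l, x ≠ 0) (a b p : ℝ) :
    Tendsto (fun x : ℝ => ((x + p) ^ 2 + b ^ 2) / (x ^ 2 + a ^ 2)) l (𝓝 1) := by
  have h1 : Tendsto (fun x : ℝ => ((1 + p * x⁻¹) ^ 2 + b ^ 2 * x⁻¹ ^ 2) / (1 + a ^ 2 * x⁻¹ ^ 2)) l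
      (𝓝 (((1 + p * 0) ^ 2 + b ^ 2 * 0 ^ 2) / (1 + a ^ 2 * 0 ^ 2))) := by
    refine Tendsto.div ?_ ?_ (by norm_num)
    · exact ((hl.const_mul p).const_add 1 |>.pow 2).add ((hl.pow 2).const_mul _)
    · exact ((hl.pow 2).const_mul _).const_add _
  have h2 : ((1 + p * 0) ^ 2 + b ^ 2 * 0 ^ 2) / (1 + a ^ 2 * 0 ^ 2) = (1 : ℝ) := by norm_num
  rw [h2] at h1
  refine h1.congr' ?_
  filter_upwards [hne] with x hx
  have : x ^ 2 + a ^ 2 ≠ 0 := by positivity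
  field_simp

lemma tendsto_log_sq_add_sq_div {l : Filter ℝ} (hl : Tendsto (fun x : ℝ => x⁻¹) l (𝓝 0))
    (hne : ∀ᶠ x in l, x ≠ 0) {a b : ℝ} (ha : 0 < a) (hb : 0 < b) (p : ℝ) :
    Tendsto (fun x : ℝ => log ((x + p) ^ 2 + b ^ 2) - log (x ^ 2 + a ^ 2)) l (𝓝 0) := by
  have h := (tendsto_sq_add_sq_div hl hne a b p).log one_ne_zero
  rw [log_one] at h
  refine h.congr fun x => ?_
  rw [log_div (by positivity) (by positivity)]

lemma hasDerivAt_log_sq_add_sq {c : ℝ} (hc : 0 < c) (p x : ℝ) :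
    HasDerivAt (fun x => log ((x + p) ^ 2 + c ^ 2)) (2 * (x + p) / ((x + p) ^ 2 + c ^ 2)) x := by
  have h := ((((hasDerivAt_id x).add_const p).pow 2).add_const (c ^ 2)).log
    (by simp only [id, Pi.pow_apply]; positivity)
  refine h.congr_deriv ?_
  simp

/-- The convolution of two Cauchy profiles is a Cauchy profile. -/
theorem integral_cauchy_mul_cauchy {a b : ℝ} (ha : 0 < a) (hb : 0 < b) (p : ℝ) :
    ∫ x : ℝ, 1 / (x ^ 2 + a ^ 2) * (1 / ((x + p) ^ 2 + b ^ 2)) =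
      π * (a + b) / (a * b * ((a + b) ^ 2 + p ^ 2)) := by
  have hint := integrable_cauchy_mul_cauchy ha hb p
  have hbot : Tendsto (fun x : ℝ => x⁻¹) atBot (𝓝 0) := tendsto_inv_atBot_zero
  have htop : Tendsto (fun x : ℝ => x⁻¹) atTop (𝓝 0) := tendsto_inv_atTop_zero
  -- When the two quadratics coincide, partial fractions fail and a separate antiderivative is
  -- needed.
  by_cases hdeg : p = 0 ∧ a = b
  · obtain ⟨rfl, rfl⟩ := hdeg
    have hd : ∀ x : ℝ, HasDerivAt
        (fun x => 1 / (2 * a ^ 3) * arctan ((x + 0) / a) + 1 / (2 * a ^ 2) * (x / (x ^ 2 + a ^ 2)))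
        (1 / (x ^ 2 + a ^ 2) * (1 / ((x + 0) ^ 2 + a ^ 2))) x := by
      intro x
      have hx : x ^ 2 + a ^ 2 ≠ 0 := by positivity
      have h := ((hasDerivAt_arctan_div ha.ne' 0 x).const_mul (1 / (2 * a ^ 3))).add
        (((hasDerivAt_id x).div (((hasDerivAt_id x).pow 2).add_const (a ^ 2))
          (by simpa using hx)).const_mul (1 / (2 * a ^ 2)))
      refine h.congr_deriv ?_
      simp only [id_eq, add_zero, Pi.pow_apply]
      push_cast
      field_simp
      ring
    have hlim : ∀ l : Filter ℝ, Tendsto (fun x : ℝ => x⁻¹) l (𝓝 0) → (∀ᶠ x in l, x ≠ 0) →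
        Tendsto (fun x : ℝ => x / (x ^ 2 + a ^ 2)) l (𝓝 0) := by
      intro l hl hne
      have h1 : Tendsto (fun x : ℝ => x⁻¹ / (1 + a ^ 2 * x⁻¹ ^ 2)) l
          (𝓝 (0 / (1 + a ^ 2 * 0 ^ 2))) :=
        hl.div (((hl.pow 2).const_mul _).const_add _) (by norm_num)
      rw [zero_div] at h1
      refine h1.congr' ?_
      filter_upwards [hne] with x hx
      have : x ^ 2 + a ^ 2 ≠ 0 := by positivity
      field_simp
    rw [integral_of_hasDerivAt_of_tendsto hd hint
      (((tendsto_arctan_div_atBot ha 0).const_mul _).add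
        ((hlim _ hbot (eventually_ne_atBot 0)).const_mul _))
      (((tendsto_arctan_div_atTop ha 0).const_mul _).add
        ((hlim _ htop (eventually_ne_atTop 0)).const_mul _))]
    field_simp
    ring
  -- This is the resultant of x² + a² and (x + p)² + b², the denominator in the partial fractions.
  -- The logarithms below cancel at ±∞, so only the arctangents contribute.
  · have hK : 4 * p ^ 2 * a ^ 2 + (p ^ 2 + b ^ 2 - a ^ 2) ^ 2 ≠ 0 := by
      intro h0
      have h1 : p ^ 2 * a ^ 2 = 0 := by nlinarith [sq_nonneg (p * a), sq_nonneg (p ^ 2 + b ^ 2 - a ^ 2)]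
      have hp : p = 0 := by
        rcases mul_eq_zero.1 h1 with h | h
        · exact pow_eq_zero_iff two_ne_zero |>.1 h
        · exact absurd h (by positivity)
      subst hp
      refine hdeg ⟨rfl, ?_⟩
      have h2 : b ^ 2 - a ^ 2 = 0 := by
        have : (b ^ 2 - a ^ 2) ^ 2 = 0 := by linarith
        exact pow_eq_zero_iff two_ne_zero |>.1 this
      nlinarith
    set k := 4 * p ^ 2 * a ^ 2 + (p ^ 2 + b ^ 2 - a ^ 2) ^ 2 with hk
    have hd : ∀ x : ℝ, HasDerivAt
        (fun x => 1 / k * (p * (log ((x + p) ^ 2 + b ^ 2) - log ((x + 0) ^ 2 + a ^ 2)) +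
          ((p ^ 2 + b ^ 2 - a ^ 2) / a * arctan ((x + 0) / a) +
            (p ^ 2 + a ^ 2 - b ^ 2) / b * arctan ((x + p) / b))))
        (1 / (x ^ 2 + a ^ 2) * (1 / ((x + p) ^ 2 + b ^ 2))) x := by
      intro x
      have hx : x ^ 2 + a ^ 2 ≠ 0 := by positivity
      have hy : (x + p) ^ 2 + b ^ 2 ≠ 0 := by positivity
      have h := (((((hasDerivAt_log_sq_add_sq hb p x).sub
        (hasDerivAt_log_sq_add_sq ha 0 x)).const_mul p).add
        (((hasDerivAt_arctan_div ha.ne' 0 x).const_mul ((p ^ 2 + b ^ 2 - a ^ 2) / a)).add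
        ((hasDerivAt_arctan_div hb.ne' p x).const_mul ((p ^ 2 + a ^ 2 - b ^ 2) / b)))).const_mul
          (1 / k))
      refine h.congr_deriv ?_
      rw [add_zero, ← sub_eq_zero]
      field_simp
      rw [hk]
      ring
    have hl0 : ∀ l : Filter ℝ, Tendsto (fun x : ℝ => x⁻¹) l (𝓝 0) → (∀ᶠ x in l, x ≠ 0) →
        Tendsto (fun x : ℝ => log ((x + p) ^ 2 + b ^ 2) - log ((x + 0) ^ 2 + a ^ 2)) l (𝓝 0) := by
      intro l hl hne
      simpa using tendsto_log_sq_add_sq_div hl hne ha hb p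
    rw [integral_of_hasDerivAt_of_tendsto hd hint
      ((((hl0 _ hbot (eventually_ne_atBot 0)).const_mul p).add
        (((tendsto_arctan_div_atBot ha 0).const_mul _).add
          ((tendsto_arctan_div_atBot hb p).const_mul _))).const_mul _)
      ((((hl0 _ htop (eventually_ne_atTop 0)).const_mul p).add
        (((tendsto_arctan_div_atTop ha 0).const_mul _).add
          ((tendsto_arctan_div_atTop hb p).const_mul _))).const_mul _)]
    have hs : (a + b) ^ 2 + p ^ 2 ≠ 0 := by positivity
    rw [← sub_eq_zero]
    field_simp
    rw [hk]
    ring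

lemma lifshitzPropagators_one (p y : EuclideanSpace ℝ (Fin 1)) (a b : ℝ) :
    lifshitzPropagators 1 p y a b = 1 / (y 0 ^ 2 + a ^ 2) * (1 / ((y 0 + p 0) ^ 2 + b ^ 2)) := by
  simp [lifshitzPropagators, EuclideanSpace.norm_eq, sq_abs, Real.sqrt_sq_eq_abs]

lemma measurePreserving_euclideanSpace_fin_one :
    MeasurePreserving ((MeasurableEquiv.toLp 2 (Fin 1 → ℝ)).symm.trans
      (MeasurableEquiv.funUnique (Fin 1) ℝ)) volume volume :=
  (volume_preserving_funUnique (Fin 1) ℝ).comp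
    (EuclideanSpace.volume_preserving_symm_measurableEquiv_toLp (Fin 1))

lemma integrable_lifshitzPropagators_one (p : EuclideanSpace ℝ (Fin 1)) {a b : ℝ}
    (ha : 0 < a) (hb : 0 < b) :
    Integrable (fun y => lifshitzPropagators 1 p y a b) := by
  simp_rw [lifshitzPropagators_one]
  exact (measurePreserving_euclideanSpace_fin_one.integrable_comp_emb
    (MeasurableEquiv.measurableEmbedding _)).2 (integrable_cauchy_mul_cauchy ha hb (p 0))

lemma integral_lifshitzPropagators_one (p : EuclideanSpace ℝ (Fin 1)) {a b : ℝ}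
    (ha : 0 < a) (hb : 0 < b) :
    ∫ y, lifshitzPropagators 1 p y a b = π * (a + b) / (a * b * ((a + b) ^ 2 + ‖p‖ ^ 2)) := by
  simp_rw [lifshitzPropagators_one]
  have h := measurePreserving_euclideanSpace_fin_one.integral_comp
    (MeasurableEquiv.measurableEmbedding _)
    (fun x : ℝ => 1 / (x ^ 2 + a ^ 2) * (1 / ((x + p 0) ^ 2 + b ^ 2)))
  rw [integral_cauchy_mul_cauchy ha hb] at h
  have hp : ‖p‖ ^ 2 = p 0 ^ 2 := by simp [EuclideanSpace.norm_eq, Real.sqrt_sq_eq_abs]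
  rw [hp]
  exact h

lemma lifshitzInner_one (p : EuclideanSpace ℝ (Fin 1)) {a b : ℝ} (ha : 0 < a) (hb : 0 < b) :
    lifshitzInner 1 p a b = (a + b) / (2 * a * b * ((a + b) ^ 2 + ‖p‖ ^ 2)) := by
  have : (a + b) ^ 2 + ‖p‖ ^ 2 ≠ 0 := by positivity
  rw [lifshitzInner, integral_div, integral_lifshitzPropagators_one p ha hb]
  field_simp

end CauchyConvolution

/-! ### Schwinger and Feynman parameters, and the incomplete beta series. -/

section ParametricIntegrals

open MeasureTheory Real Set Filter Topology

/-- The Bochner integral of a non-integrable function is 0 by convention, so a nonzero value already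
forces integrability. -/
lemma lintegral_ofReal_of_integral_eq {α : Type*} [MeasurableSpace α] {μ : Measure α} {f : α → ℝ}
    {c : ℝ} (h0 : 0 ≤ᵐ[μ] f) (h : ∫ x, f x ∂μ = c) (hc : c ≠ 0) :
    ∫⁻ x, ENNReal.ofReal (f x) ∂μ = ENNReal.ofReal c := by
  rw [← h, ofReal_integral_eq_lintegral_ofReal _ h0]
  exact Integrable.of_integral_ne_zero (h ▸ hc)

lemma lintegral_rpow_mul_exp_neg_mul_Ioi {a r : ℝ} (ha : 0 < a) (hr : 0 < r) :
    ∫⁻ t in Ioi (0 : ℝ), ENNReal.ofReal (t ^ (a - 1) * exp (-(r * t))) =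
      ENNReal.ofReal ((1 / r) ^ a * Gamma a) := by
  refine lintegral_ofReal_of_integral_eq ?_ (integral_rpow_mul_exp_neg_mul_Ioi ha hr) ?_
  · filter_upwards [ae_restrict_mem measurableSet_Ioi] with t ht
    have : (0 : ℝ) < t := ht
    simp only [Pi.zero_apply]
    positivity
  · have := Gamma_pos_of_pos ha
    positivity

lemma lintegral_pow_mul_exp_neg_mul_Ioi (n : ℕ) {r : ℝ} (hr : 0 < r) :
    ∫⁻ t in Ioi (0 : ℝ), ENNReal.ofReal (t ^ n * exp (-(r * t))) =
      ENNReal.ofReal (n.factorial / r ^ (n + 1)) := by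
  have h := lintegral_rpow_mul_exp_neg_mul_Ioi (a := n + 1) (by positivity) hr
  rw [Gamma_nat_eq_factorial, ← Nat.cast_succ, rpow_natCast] at h
  simp only [Nat.succ_eq_add_one, Nat.cast_add, Nat.cast_one, add_sub_cancel_right,
    rpow_natCast] at h
  rw [h]
  congr 1
  rw [one_div, inv_pow]
  field_simp

lemma convex_comb_pos {a b w : ℝ} (ha : 0 < a) (hb : 0 < b) (h0 : 0 ≤ w) (h1 : w ≤ 1) :
    0 < (1 - w) * a + w * b := by
  rcases h0.eq_or_lt with rfl | h
  · simpa
  · have : 0 ≤ (1 - w) * a := mul_nonneg (by linarith) ha.le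
    positivity

/-- A Feynman parametrization of `1 / (a (a + b) ^ (n + 1))`. -/
lemma lintegral_feynman_parameter (n : ℕ) {a b : ℝ} (ha : 0 < a) (hb : 0 < b) :
    ∫⁻ w in Ioo (0 : ℝ) (1 / 2),
        ENNReal.ofReal ((n + 1) * w ^ n / ((1 - w) * a + w * b) ^ (n + 2)) =
      ENNReal.ofReal (1 / (a * (a + b) ^ (n + 1))) := by
  have hd : ∀ w ∈ Icc (0 : ℝ) (1 / 2), 0 < (1 - w) * a + w * b := fun w hw =>
    convex_comb_pos ha hb hw.1 (by linarith [hw.2])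
  have hu : uIcc (0 : ℝ) (1 / 2) = Icc 0 (1 / 2) := uIcc_of_le (by norm_num)
  -- The substitution u = w / ((1 - w)a + wb) has du/dw = a / ((1 - w)a + wb)², and w = 1/2 gives u
  -- = 1/(a + b).
  have hder : ∀ w ∈ uIcc (0 : ℝ) (1 / 2),
      HasDerivAt (fun w => 1 / a * (w / ((1 - w) * a + w * b)) ^ (n + 1))
        ((n + 1) * w ^ n / ((1 - w) * a + w * b) ^ (n + 2)) w := by
    intro w hw
    rw [hu] at hw
    have hw' := (hd w hw).ne'
    have h := ((((hasDerivAt_id w).div ((((hasDerivAt_id w).const_sub 1).mul_const a).add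
      ((hasDerivAt_id w).mul_const b)) hw').pow (n + 1)).const_mul (1 / a))
    refine h.congr_deriv ?_
    simp only [id_eq, Pi.add_apply, Pi.div_apply, Nat.add_sub_cancel]
    push_cast
    rw [div_pow]
    field_simp
    ring
  have hcont : ContinuousOn
      (fun w : ℝ => (n + 1) * w ^ n / ((1 - w) * a + w * b) ^ (n + 2)) (uIcc 0 (1 / 2)) := by
    rw [hu]
    refine ContinuousOn.div (by fun_prop) (by fun_prop) fun w hw => ?_
    have := hd w hw
    positivity
  have hI := intervalIntegral.integral_eq_sub_of_hasDerivAt hder hcont.intervalIntegrable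
  rw [intervalIntegral.integral_of_le (by norm_num), integral_Ioc_eq_integral_Ioo] at hI
  refine lintegral_ofReal_of_integral_eq ?_ (hI.trans ?_) (by positivity)
  · filter_upwards [ae_restrict_mem measurableSet_Ioo] with w hw
    have := hd w ⟨hw.1.le, hw.2.le⟩
    have := hw.1
    simp only [Pi.zero_apply]
    positivity
  · have h1 : (1 - 1 / 2) * a + 1 / 2 * b = (a + b) / 2 := by ring
    rw [h1]
    have h2 : (1 / 2 : ℝ) / ((a + b) / 2) = 1 / (a + b) := by field_simp
    rw [h2, zero_div, zero_pow n.succ_ne_zero, one_div_pow]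
    field_simp
    simp

/-- A Gaussian representation of `1 / (a (a + b) ^ (n + 1))`. -/
lemma lintegral_schwinger_feynman (n : ℕ) {a b : ℝ} (ha : 0 < a) (hb : 0 < b) :
    ∫⁻ w in Ioo (0 : ℝ) (1 / 2), ∫⁻ t in Ioi (0 : ℝ),
        ENNReal.ofReal (w ^ n * t ^ (n + 1) * exp (-(t * (1 - w)) * a - t * w * b)) =
      ENNReal.ofReal (n.factorial / (a * (a + b) ^ (n + 1))) := by
  have hin : ∀ w ∈ Ioo (0 : ℝ) (1 / 2), ∫⁻ t in Ioi (0 : ℝ),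
        ENNReal.ofReal (w ^ n * t ^ (n + 1) * exp (-(t * (1 - w)) * a - t * w * b)) =
      ENNReal.ofReal n.factorial *
        ENNReal.ofReal ((n + 1) * w ^ n / ((1 - w) * a + w * b) ^ (n + 2)) := by
    intro w hw
    have hp := convex_comb_pos ha hb hw.1.le (by linarith [hw.2])
    have hw0 := hw.1
    have h : ∀ t : ℝ, ENNReal.ofReal (w ^ n * t ^ (n + 1) * exp (-(t * (1 - w)) * a - t * w * b)) =
        ENNReal.ofReal (w ^ n) *
          ENNReal.ofReal (t ^ (n + 1) * exp (-(((1 - w) * a + w * b) * t))) := by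
      intro t
      rw [← ENNReal.ofReal_mul (by positivity), mul_assoc]
      congr 4
      ring
    simp_rw [h]
    rw [lintegral_const_mul' _ _ ENNReal.ofReal_ne_top, lintegral_pow_mul_exp_neg_mul_Ioi _ hp,
      ← ENNReal.ofReal_mul (by positivity), ← ENNReal.ofReal_mul (by positivity),
      Nat.factorial_succ]
    congr 1
    push_cast
    ring
  rw [setLIntegral_congr_fun measurableSet_Ioo hin,
    lintegral_const_mul' _ _ ENNReal.ofReal_ne_top, lintegral_feynman_parameter n ha hb,
    ← ENNReal.ofReal_mul (by positivity)]
  congr 1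
  ring

lemma poch_pos {a : ℝ} (ha : 0 < a) (n : ℕ) : 0 < poch a n := ascPochhammer_pos n a ha

lemma hasSum_one_sub_rpow_neg (σ : ℝ) {w : ℝ} (h0 : 0 ≤ w) (h1 : w < 1) :
    HasSum (fun j : ℕ => poch σ j / j.factorial * w ^ j) ((1 - w) ^ (-σ)) := by
  have h := (Real.one_div_one_sub_rpow_hasFPowerSeriesOnBall_zero σ).hasSum (y := w) (by
    rw [Metric.mem_eball, edist_dist, dist_zero_right, Real.norm_of_nonneg h0]
    simpa using h1)
  simp only [zero_add, FormalMultilinearSeries.ofScalars_apply_eq] at h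
  rw [one_div, ← rpow_neg (by linarith)] at h
  refine h.congr_fun fun j => ?_
  have h2 := Ring.factorial_nsmul_multichoose_eq_ascPochhammer σ j
  rw [Polynomial.ascPochhammer_smeval_eq_eval, nsmul_eq_mul] at h2
  -- The series has coefficients `Ring.choose (σ + j - 1) j`, which unfold to a `multichoose` with
  -- this upper argument.
  have h3 : σ + j - 1 - j + 1 = σ := by ring
  have hj : (j.factorial : ℝ) ≠ 0 := by positivity
  rw [Ring.choose, h3, poch, ← h2, smul_eq_mul]
  field_simp

lemma lintegral_Ioo_rpow {ε : ℝ} (hε : 0 < ε) :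
    ∫⁻ w in Ioo (0 : ℝ) (1 / 2), ENNReal.ofReal (w ^ (ε - 1)) =
      ENNReal.ofReal ((1 / 2) ^ ε / ε) := by
  have h := integral_rpow (a := 0) (b := 1 / 2) (r := ε - 1) (Or.inl (by linarith))
  rw [intervalIntegral.integral_of_le (by norm_num), integral_Ioc_eq_integral_Ioo,
    sub_add_cancel, zero_rpow hε.ne', sub_zero] at h
  refine lintegral_ofReal_of_integral_eq ?_ h (by positivity)
  filter_upwards [ae_restrict_mem measurableSet_Ioo] with w hw
  exact rpow_nonneg hw.1.le _

/-- The terms of the expansion of the incomplete beta integral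
`∫_0^{1/2} w ^ (ε - 1) (1 - w) ^ (-σ) dw`. -/
noncomputable def betaCoeff (ε σ : ℝ) (j : ℕ) : ℝ :=
  poch σ j / j.factorial * ((1 / 2) ^ (ε + j) / (ε + j))

lemma betaCoeff_nonneg {ε σ : ℝ} (hε : 0 < ε) (hσ : 0 < σ) (j : ℕ) : 0 ≤ betaCoeff ε σ j := by
  have := poch_pos hσ j
  unfold betaCoeff
  positivity

/-- As 1/(ε + j) ≤ 1/ε, the binomial series at w = 1/2 dominates. -/
lemma summable_betaCoeff {ε σ : ℝ} (hε : 0 < ε) (hσ : 0 < σ) : Summable (betaCoeff ε σ) := by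
  have h := ((hasSum_one_sub_rpow_neg σ (w := 1 / 2) (by norm_num) (by norm_num)).summable).mul_right
    ((1 / 2) ^ ε / ε)
  refine Summable.of_nonneg_of_le (betaCoeff_nonneg hε hσ) (fun j => ?_) h
  have hp := poch_pos hσ j
  have h2 : ((1 : ℝ) / 2) ^ (ε + j) = (1 / 2) ^ j * (1 / 2) ^ ε := by
    rw [rpow_add (by norm_num), rpow_natCast, mul_comm]
  rw [betaCoeff, mul_assoc, h2, mul_div_assoc]
  gcongr
  simp

lemma lintegral_incomplete_beta {ε σ : ℝ} (hε : 0 < ε) (hσ : 0 < σ) :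
    ∫⁻ w in Ioo (0 : ℝ) (1 / 2), ENNReal.ofReal (w ^ (ε - 1) * (1 - w) ^ (-σ)) =
      ENNReal.ofReal (∑' j, betaCoeff ε σ j) := by
  have hin : ∀ w ∈ Ioo (0 : ℝ) (1 / 2), ENNReal.ofReal (w ^ (ε - 1) * (1 - w) ^ (-σ)) =
      ∑' j : ℕ, ENNReal.ofReal (poch σ j / j.factorial) * ENNReal.ofReal (w ^ (ε + j - 1)) := by
    intro w hw
    have hw0 : 0 < w := hw.1
    have hs := (hasSum_one_sub_rpow_neg σ hw.1.le (by linarith [hw.2])).mul_left (w ^ (ε - 1))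
    rw [← hs.tsum_eq, ENNReal.ofReal_tsum_of_nonneg _ hs.summable]
    · refine tsum_congr fun j => ?_
      have := poch_pos hσ j
      rw [← ENNReal.ofReal_mul (by positivity), add_sub_right_comm, rpow_add hw0, rpow_natCast]
      congr 1
      ring
    · intro j
      have := poch_pos hσ j
      positivity
  rw [setLIntegral_congr_fun measurableSet_Ioo hin, lintegral_tsum (fun j => by fun_prop),
    ENNReal.ofReal_tsum_of_nonneg (betaCoeff_nonneg hε hσ) (summable_betaCoeff hε hσ)]
  refine tsum_congr fun j => ?_
  have := poch_pos hσ j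
  rw [lintegral_const_mul' _ _ ENNReal.ofReal_ne_top, lintegral_Ioo_rpow (by positivity),
    ← ENNReal.ofReal_mul (by positivity), betaCoeff]

end ParametricIntegrals

/-! ### Moments and bubble integral from the joint Laplace transform. -/

section GaussianPair

open MeasureTheory Real Set Filter Topology

/-- The functions `a` and `b` have the joint Laplace transform of `‖x‖²` and `‖x + v‖²`
with respect to `d^m x / (2π)^m`, where `m = 2 + 2 ε` and `‖v‖ = q`. -/
def HasGaussianLaw {X : Type*} [MeasurableSpace X] (μ : Measure X) (a b : X → ℝ) (ε q : ℝ) : Prop :=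
  ∀ A B : ℝ, 0 < A → 0 < B →
    ∫⁻ x, ENNReal.ofReal (exp (-A * a x - B * b x)) ∂μ =
      ENNReal.ofReal ((4 * π * (A + B)) ^ (-(1 + ε)) * exp (-(q ^ 2 * (A * B) / (A + B))))

lemma HasGaussianLaw.symm {X : Type*} [MeasurableSpace X] {μ : Measure X} {a b : X → ℝ} {ε q : ℝ}
    (h : HasGaussianLaw μ a b ε q) : HasGaussianLaw μ b a ε q := by
  intro A B hA hB
  rw [add_comm A B, mul_comm A B, ← h B A hB hA]
  refine lintegral_congr fun x => ?_
  congr 2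
  ring

/-- The value of `∫ 1 / (a (a + b) ^ (n + 1))` for a pair with a Gaussian law. -/
noncomputable def gaussianMoment (ε q : ℝ) (n : ℕ) : ℝ :=
  (4 * π) ^ (-(1 + ε)) * Gamma (n + 1 - ε) * (q ^ 2) ^ (-(n + 1 - ε)) / n.factorial *
    ∑' j, betaCoeff ε (n + 1 - ε) j

lemma gaussianMoment_nonneg {ε q : ℝ} (hε : 0 < ε) {n : ℕ} (hσ : 0 < n + 1 - ε) :
    0 ≤ gaussianMoment ε q n := by
  have := Gamma_pos_of_pos hσ
  have : 0 ≤ ∑' j, betaCoeff ε (n + 1 - ε) j := tsum_nonneg (betaCoeff_nonneg hε hσ)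
  unfold gaussianMoment
  positivity

/-- For A = t(1 - w) and B = tw one has A + B = t and AB/(A + B) = tw(1 - w), so this is a Gamma
integral of exponent σ = n + 1 - ε; the factor w^n turns w^(-σ) into w^(ε-1). -/
lemma lintegral_gaussian_parameter {ε q : ℝ} (hq : 0 < q) {n : ℕ} (hσ : 0 < n + 1 - ε)
    {w : ℝ} (hw : w ∈ Ioo (0 : ℝ) (1 / 2)) :
    ∫⁻ t in Ioi (0 : ℝ), ENNReal.ofReal (w ^ n * t ^ (n + 1)) *
        ENNReal.ofReal ((4 * π * (t * (1 - w) + t * w)) ^ (-(1 + ε)) *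
          exp (-(q ^ 2 * (t * (1 - w) * (t * w)) / (t * (1 - w) + t * w)))) =
      ENNReal.ofReal ((4 * π) ^ (-(1 + ε)) * Gamma (n + 1 - ε) * (q ^ 2) ^ (-(n + 1 - ε))) *
        ENNReal.ofReal (w ^ (ε - 1) * (1 - w) ^ (-(n + 1 - ε))) := by
  have hw0 : 0 < w := hw.1
  have hw1 : 0 < 1 - w := by linarith [hw.2]
  have hG := Gamma_pos_of_pos hσ
  have hin : ∀ t ∈ Ioi (0 : ℝ), ENNReal.ofReal (w ^ n * t ^ (n + 1)) *
        ENNReal.ofReal ((4 * π * (t * (1 - w) + t * w)) ^ (-(1 + ε)) *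
          exp (-(q ^ 2 * (t * (1 - w) * (t * w)) / (t * (1 - w) + t * w)))) =
      ENNReal.ofReal (w ^ n * (4 * π) ^ (-(1 + ε))) *
        ENNReal.ofReal (t ^ ((n + 1 - ε) - 1) * exp (-((q ^ 2 * (w * (1 - w))) * t))) := by
    intro t ht
    have ht0 : 0 < t := ht
    rw [← ENNReal.ofReal_mul (by positivity), ← ENNReal.ofReal_mul (by positivity)]
    have h1 : t * (1 - w) + t * w = t := by ring
    have h2 : q ^ 2 * (t * (1 - w) * (t * w)) / t = (q ^ 2 * (w * (1 - w))) * t := by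
      field_simp
    have h3 : t ^ ((n + 1 - ε) - 1) = t ^ (n + 1) * t ^ (-(1 + ε)) := by
      rw [← rpow_natCast t (n + 1), ← rpow_add ht0]
      congr 1
      push_cast
      ring
    rw [h1, h2, h3, mul_rpow (by positivity) ht0.le]
    congr 1
    ring
  rw [setLIntegral_congr_fun measurableSet_Ioi hin,
    lintegral_const_mul' _ _ ENNReal.ofReal_ne_top,
    lintegral_rpow_mul_exp_neg_mul_Ioi hσ (by positivity), ← ENNReal.ofReal_mul (by positivity),
    ← ENNReal.ofReal_mul (by positivity)]
  have h4 : w ^ (ε - 1) = w ^ n * w ^ (-(n + 1 - ε)) := by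
    rw [← rpow_natCast w n, ← rpow_add hw0]
    congr 1
    ring
  rw [one_div, inv_rpow (by positivity), ← rpow_neg (by positivity), 
    mul_rpow (x := q ^ 2) (by positivity) (mul_nonneg hw0.le hw1.le), mul_rpow hw0.le hw1.le, h4]
  congr 1
  ring

variable {X : Type*} [MeasurableSpace X] {μ : Measure X} [SFinite μ] {a b : X → ℝ} {ε q : ℝ}

lemma HasGaussianLaw.lintegral_one_div_mul_add_pow (h : HasGaussianLaw μ a b ε q)
    (ha : Measurable a) (hb : Measurable b) (ha0 : ∀ᵐ x ∂μ, 0 < a x) (hb0 : ∀ᵐ x ∂μ, 0 < b x)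
    (hε : 0 < ε) (hq : 0 < q) (n : ℕ) (hσ : 0 < n + 1 - ε) :
    ∫⁻ x, ENNReal.ofReal (1 / (a x * (a x + b x) ^ (n + 1))) ∂μ =
      ENNReal.ofReal (gaussianMoment ε q n) := by
  have hG := Gamma_pos_of_pos hσ
  have e1 : ∫⁻ x, ENNReal.ofReal (1 / (a x * (a x + b x) ^ (n + 1))) ∂μ =
      ∫⁻ x, ENNReal.ofReal (1 / n.factorial) * (∫⁻ w in Ioo (0 : ℝ) (1 / 2), ∫⁻ t in Ioi (0 : ℝ),
        ENNReal.ofReal (w ^ n * t ^ (n + 1) *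
          exp (-(t * (1 - w)) * a x - t * w * b x))) ∂μ := by
    refine lintegral_congr_ae ?_
    filter_upwards [ha0, hb0] with x hax hbx
    rw [lintegral_schwinger_feynman n hax hbx, ← ENNReal.ofReal_mul (by positivity)]
    congr 1
    field_simp
  have e2 : ∀ w ∈ Ioo (0 : ℝ) (1 / 2), ∫⁻ x, (∫⁻ t in Ioi (0 : ℝ),
        ENNReal.ofReal (w ^ n * t ^ (n + 1) * exp (-(t * (1 - w)) * a x - t * w * b x))) ∂μ =
      ENNReal.ofReal ((4 * π) ^ (-(1 + ε)) * Gamma (n + 1 - ε) * (q ^ 2) ^ (-(n + 1 - ε))) *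
        ENNReal.ofReal (w ^ (ε - 1) * (1 - w) ^ (-(n + 1 - ε))) := by
    intro w hw
    rw [lintegral_lintegral_swap (by fun_prop), ← lintegral_gaussian_parameter hq hσ hw]
    refine setLIntegral_congr_fun measurableSet_Ioi fun t ht => ?_
    have ht0 : 0 < t := ht
    have hw0 : 0 < w := hw.1
    have hw1 : 0 < 1 - w := by linarith [hw.2]
    rw [← h _ _ (by positivity) (by positivity), ← lintegral_const_mul' _ _ ENNReal.ofReal_ne_top]
    refine lintegral_congr fun x => ?_
    rw [← ENNReal.ofReal_mul (by positivity)]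
  rw [e1, lintegral_const_mul' _ _ ENNReal.ofReal_ne_top, lintegral_lintegral_swap,
    setLIntegral_congr_fun measurableSet_Ioo e2, lintegral_const_mul' _ _ ENNReal.ofReal_ne_top,
    lintegral_incomplete_beta hε hσ, ← ENNReal.ofReal_mul (by positivity),
    ← ENNReal.ofReal_mul (by positivity)]
  · congr 1
    rw [gaussianMoment]
    ring
  · refine Measurable.aemeasurable ?_
    refine Measurable.lintegral_prod_right' (f := fun z : (X × ℝ) × ℝ =>
      ENNReal.ofReal (z.1.2 ^ n * z.2 ^ (n + 1) *
        exp (-(z.2 * (1 - z.1.2)) * a z.1.1 - z.2 * z.1.2 * b z.1.1))) ?_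
    fun_prop

/-- Split 1/(ab) = (1/a + 1/b)/(a + b); the law is symmetric in a and b, so both halves have the
same integral. -/
lemma HasGaussianLaw.lintegral_one_div_mul_mul_add_pow (h : HasGaussianLaw μ a b ε q)
    (ha : Measurable a) (hb : Measurable b) (ha0 : ∀ᵐ x ∂μ, 0 < a x) (hb0 : ∀ᵐ x ∂μ, 0 < b x)
    (hε : 0 < ε) (hq : 0 < q) (n : ℕ) (hσ : 0 < n + 1 - ε) :
    ∫⁻ x, ENNReal.ofReal (1 / (2 * a x * b x * (a x + b x) ^ n)) ∂μ =
      ENNReal.ofReal (gaussianMoment ε q n) := by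
  have e1 : ∫⁻ x, ENNReal.ofReal (1 / (2 * a x * b x * (a x + b x) ^ n)) ∂μ =
      ∫⁻ x, ENNReal.ofReal (1 / 2) * (ENNReal.ofReal (1 / (a x * (a x + b x) ^ (n + 1))) +
        ENNReal.ofReal (1 / (b x * (b x + a x) ^ (n + 1)))) ∂μ := by
    refine lintegral_congr_ae ?_
    filter_upwards [ha0, hb0] with x hax hbx
    rw [← ENNReal.ofReal_add (by positivity) (by positivity), ← ENNReal.ofReal_mul (by positivity),
      add_comm (b x) (a x)]
    congr 1
    field_simp
    ring
  have := gaussianMoment_nonneg (q := q) hε hσ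
  rw [e1, lintegral_const_mul' _ _ ENNReal.ofReal_ne_top, lintegral_add_left (by fun_prop),
    h.lintegral_one_div_mul_add_pow ha hb ha0 hb0 hε hq n hσ,
    h.symm.lintegral_one_div_mul_add_pow hb ha hb0 ha0 hε hq n hσ,
    ← ENNReal.ofReal_add this this, ← ENNReal.ofReal_mul (by positivity)]
  congr 1
  ring

lemma HasGaussianLaw.integrable_and_integral (h : HasGaussianLaw μ a b ε q)
    (ha : Measurable a) (hb : Measurable b) (ha0 : ∀ᵐ x ∂μ, 0 < a x) (hb0 : ∀ᵐ x ∂μ, 0 < b x)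
    (hε : 0 < ε) (hq : 0 < q) (n : ℕ) (hσ : 0 < n + 1 - ε) :
    Integrable (fun x => 1 / (2 * a x * b x * (a x + b x) ^ n)) μ ∧
      ∫ x, 1 / (2 * a x * b x * (a x + b x) ^ n) ∂μ = gaussianMoment ε q n := by
  have hnn : 0 ≤ᵐ[μ] fun x => 1 / (2 * a x * b x * (a x + b x) ^ n) := by
    filter_upwards [ha0, hb0] with x hax hbx
    simp only [Pi.zero_apply]
    positivity
  have hm : Measurable fun x => 1 / (2 * a x * b x * (a x + b x) ^ n) := by fun_prop
  have hl := h.lintegral_one_div_mul_mul_add_pow ha hb ha0 hb0 hε hq n hσ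
  refine ⟨⟨hm.aestronglyMeasurable, ?_⟩, ?_⟩
  · rw [hasFiniteIntegral_iff_ofReal hnn, hl]
    exact ENNReal.ofReal_lt_top
  · rw [integral_eq_lintegral_of_nonneg_ae hnn hm.aestronglyMeasurable, hl,
      ENNReal.toReal_ofReal (gaussianMoment_nonneg hε hσ)]

/-- The moments of a Gaussian pair decay geometrically, and the integral of the bubble
`(a + b) / (2 a b ((a + b)² + P²))` is their generating function. -/
theorem HasGaussianLaw.integral_bubble (h : HasGaussianLaw μ a b ε q)
    (ha : Measurable a) (hb : Measurable b) (ha0 : ∀ᵐ x ∂μ, 0 < a x) (hb0 : ∀ᵐ x ∂μ, 0 < b x)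
    (hab : ∀ᵐ x ∂μ, q ^ 2 / 2 ≤ a x + b x) (hε : 0 < ε) (hε2 : ε < 2) (hq : 0 < q)
    {P : ℝ} (hP : 4 * P ^ 2 / q ^ 4 < 1) :
    Integrable (fun x => (a x + b x) / (2 * a x * b x * ((a x + b x) ^ 2 + P ^ 2))) μ ∧
    Summable (fun k : ℕ => (P ^ 2) ^ k * gaussianMoment ε q (2 * k + 1)) ∧
    ∫ x, (a x + b x) / (2 * a x * b x * ((a x + b x) ^ 2 + P ^ 2)) ∂μ =
      ∑' k : ℕ, (-P ^ 2) ^ k * gaussianMoment ε q (2 * k + 1) := by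
  -- The case k = 0 is where ε < 2, that is m < 6, is needed.
  have hσ : ∀ k : ℕ, 0 < ((2 * k + 1 : ℕ) : ℝ) + 1 - ε := by
    intro k
    push_cast
    have : (0 : ℝ) ≤ k := k.cast_nonneg
    linarith
  have hI := fun k : ℕ =>
    h.integrable_and_integral ha hb ha0 hb0 hε hq (2 * k + 1) (hσ k)
  have hM : ∀ k : ℕ, gaussianMoment ε q (2 * k + 1) ≤ (4 / q ^ 4) ^ k * gaussianMoment ε q 1 := by
    intro k
    have h0 := hI 0
    rw [mul_zero, zero_add] at h0
    rw [← (hI k).2, ← h0.2, ← integral_const_mul]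
    refine integral_mono_ae (hI k).1 (h0.1.const_mul _) ?_
    filter_upwards [ha0, hb0, hab] with x hax hbx hx
    have e1 : 1 / (2 * a x * b x * (a x + b x) ^ (2 * k + 1)) =
        (1 / (a x + b x) ^ 2) ^ k * (1 / (2 * a x * b x * (a x + b x) ^ 1)) := by
      rw [one_div_pow, ← pow_mul, pow_succ]
      field_simp
    have e2 : 1 / (a x + b x) ^ 2 ≤ 4 / q ^ 4 := by
      rw [div_le_div_iff₀ (by positivity) (by positivity)]
      nlinarith [pow_le_pow_left₀ (by positivity) hx 2]
    rw [e1]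
    exact mul_le_mul_of_nonneg_right (pow_le_pow_left₀ (by positivity) e2 k) (by positivity)
  have hS : Summable (fun k : ℕ => (P ^ 2) ^ k * gaussianMoment ε q (2 * k + 1)) := by
    refine Summable.of_nonneg_of_le
      (fun k => mul_nonneg (by positivity) (gaussianMoment_nonneg hε (hσ k))) (fun k => ?_)
      ((summable_geometric_of_lt_one (by positivity) hP).mul_right (gaussianMoment ε q 1))
    have e : (4 * P ^ 2 / q ^ 4) ^ k * gaussianMoment ε q 1 =
        (P ^ 2) ^ k * ((4 / q ^ 4) ^ k * gaussianMoment ε q 1) := by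
      rw [← mul_assoc, ← mul_pow]
      congr 2
      ring
    rw [e]
    exact mul_le_mul_of_nonneg_left (hM k) (by positivity)
  refine ⟨?_, hS, ?_⟩
  -- Dropping P² only enlarges the integrand, so the moment n = 1 dominates.
  · have h0 := (hI 0).1
    have hm : Measurable fun x => (a x + b x) / (2 * a x * b x * ((a x + b x) ^ 2 + P ^ 2)) := by
      fun_prop
    refine h0.mono' hm.aestronglyMeasurable ?_
    filter_upwards [ha0, hb0] with x hax hbx
    rw [Real.norm_of_nonneg (by positivity), div_le_div_iff₀ (by positivity) (by positivity)]
    have : 0 ≤ 2 * a x * b x * P ^ 2 := by positivity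
    linear_combination this
  · have hs := hasSum_integral_of_summable_integral_norm
      (F := fun (k : ℕ) x => (-P ^ 2) ^ k * (1 / (2 * a x * b x * (a x + b x) ^ (2 * k + 1))))
      (fun k => (hI k).1.const_mul _) (hS.congr fun k => by
        rw [← (hI k).2, ← integral_const_mul]
        refine integral_congr_ae ?_
        filter_upwards [ha0, hb0] with x hax hbx
        rw [norm_mul, norm_pow, norm_neg, Real.norm_of_nonneg (sq_nonneg P),
          Real.norm_of_nonneg (by positivity)])
    have hs2 := hs.tsum_eq
    simp_rw [integral_const_mul, fun k => (hI k).2] at hs2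
    rw [hs2]
    refine integral_congr_ae ?_
    filter_upwards [ha0, hb0, hab] with x hax hbx hx
    have hpos : 0 < a x + b x := by positivity
    have hr : |-P ^ 2 / (a x + b x) ^ 2| < 1 := by
      rw [neg_div, abs_neg, abs_of_nonneg (by positivity), div_lt_one (by positivity)]
      rw [div_lt_one (by positivity)] at hP
      nlinarith [pow_le_pow_left₀ (by positivity) hx 2]
    have hg := (hasSum_geometric_of_abs_lt_one hr).mul_right (1 / (2 * a x * b x * (a x + b x)))
    have hne : (a x + b x) ^ 2 + P ^ 2 ≠ 0 := by positivity
    have e : ∀ k : ℕ, (-P ^ 2) ^ k * (1 / (2 * a x * b x * (a x + b x) ^ (2 * k + 1))) =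
        (-P ^ 2 / (a x + b x) ^ 2) ^ k * (1 / (2 * a x * b x * (a x + b x))) := by
      intro k
      rw [div_pow, ← pow_mul]
      field_simp
      ring
    simp_rw [e]
    rw [hg.tsum_eq]
    have h1 : 1 - -P ^ 2 / (a x + b x) ^ 2 = ((a x + b x) ^ 2 + P ^ 2) / (a x + b x) ^ 2 := by
      field_simp
      ring
    rw [h1]
    field_simp

end GaussianPair

/-! ### Identification of the moment series with H₄. -/

section HornSeries

open Real

lemma poch_zero (a : ℝ) : poch a 0 = 1 := by simp [poch]

lemma poch_succ (a : ℝ) (n : ℕ) : poch a (n + 1) = poch a n * (a + n) := by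
  simp [poch, ascPochhammer_succ_right]

lemma poch_add (a : ℝ) (n k : ℕ) : poch a (n + k) = poch a n * poch (a + n) k := by
  induction k with
  | zero => simp [poch_zero]
  | succ k ih =>
    rw [← add_assoc, poch_succ, ih, poch_succ]
    push_cast
    ring

lemma Gamma_mul_poch {a : ℝ} (ha : 0 < a) (n : ℕ) : Gamma a * poch a n = Gamma (a + n) := by
  induction n with
  | zero => simp [poch_zero]
  | succ n ih =>
    have : a + n ≠ 0 := by positivity
    rw [poch_succ, ← mul_assoc, ih, Nat.cast_succ, ← add_assoc, Gamma_add_one this, mul_comm]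

/-- Both sides are (ε)_{n+1}. It converts the factor 1/(ε + n) of the beta series into the
parameters ε and 1 + ε of H₄. -/
lemma poch_mul_add {ε : ℝ} (n : ℕ) : poch ε n * (ε + n) = ε * poch (1 + ε) n := by
  induction n with
  | zero => simp [poch_zero]
  | succ n ih =>
    rw [poch_succ, poch_succ, ih]
    push_cast
    ring

/-- Separating even and odd factors of (2k + 1)! produces the parameter 3/2 and the 1/4 in the first
argument of H₄. -/
lemma poch_three_halves (k : ℕ) :
    poch (3 / 2) k * k.factorial * 4 ^ k = (2 * k + 1).factorial := by
  induction k with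
  | zero => simp [poch_zero]
  | succ k ih =>
    have e : 2 * (k + 1) + 1 = 2 * k + 1 + 1 + 1 := by ring
    rw [poch_succ, e, Nat.factorial_succ (2 * k + 1 + 1), Nat.factorial_succ (2 * k + 1),
      Nat.factorial_succ k]
    push_cast
    rw [← ih]
    ring

/-- The coupled symbol arises from Γ(2 - ε)(2 - ε)_{2k+n} = Γ(2k + 2 - ε)(2k + 2 - ε)_n; the power
(1/2)^ε from the beta series turns 4π into 8π. -/
lemma const_mul_hornH4Term {ε q : ℝ} (hε : 0 < ε) (hε2 : ε < 2) (hq : 0 < q) (P : ℝ) (n k : ℕ) :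
    q ^ (-4 + 2 * ε) * (2 * Gamma (2 - ε) / (ε * (8 * π) ^ (1 + ε))) *
        hornH4Term (2 - ε) ε (3 / 2) (1 + ε) (-P ^ 2 / (4 * q ^ 4)) (1 / 2) (n, k) =
      (-P ^ 2) ^ k * ((4 * π) ^ (-(1 + ε)) * Gamma ((2 * k + 1 : ℕ) + 1 - ε) *
        (q ^ 2) ^ (-((2 * k + 1 : ℕ) + 1 - ε)) / (2 * k + 1).factorial *
          betaCoeff ε ((2 * k + 1 : ℕ) + 1 - ε) n) := by
  have hσ : ((2 * k + 1 : ℕ) : ℝ) + 1 - ε = 2 - ε + (2 * k : ℕ) := by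
    push_cast
    ring
  have h2 : 0 < 2 - ε := by linarith
  have hp1 := poch_pos (a := 1 + ε) (by positivity) n
  have hp2 := poch_pos (a := 3 / 2) (by positivity) k
  have hA : poch ε n = ε / (ε + n) * poch (1 + ε) n := by
    have := poch_mul_add (ε := ε) n
    field_simp
    linarith
  have hB : poch (2 - ε) (2 * k + n) = poch (2 - ε) (2 * k) * poch (2 - ε + (2 * k : ℕ)) n :=
    poch_add _ _ _
  have hq2 : (q ^ 2) ^ (-(2 - ε + (2 * k : ℕ))) = q ^ (-4 + 2 * ε) / (q ^ 4) ^ k := by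
    rw [← pow_mul, ← rpow_natCast q (4 * k), ← rpow_natCast q 2, ← rpow_mul hq.le, ← rpow_sub hq]
    congr 1
    push_cast
    ring
  have h8 : (8 * π) ^ (1 + ε) = (4 * π) ^ (1 + ε) * 2 ^ (1 + ε) := by
    rw [← mul_rpow (by positivity) (by positivity)]
    congr 1
    ring
  have hhalf : ((1 : ℝ) / 2) ^ (ε + n) = 2 * (1 / 2) ^ n / 2 ^ (1 + ε) := by
    rw [rpow_add (by norm_num), rpow_natCast, rpow_add (by norm_num), rpow_one, one_div,
      inv_rpow (by norm_num)]
    field_simp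
  have h4 : (-P ^ 2 / (4 * q ^ 4)) ^ k = (-P ^ 2) ^ k / (4 ^ k * (q ^ 4) ^ k) := by
    rw [div_pow, mul_pow]
  rw [hσ, ← Gamma_mul_poch h2, hq2, ← poch_three_halves, betaCoeff, hhalf, hornH4Term, h8, h4,
    rpow_neg (by positivity)]
  simp only
  rw [hB, hA]
  field_simp

lemma summable_and_const_mul_hornH4 {ε q P : ℝ} (hε : 0 < ε) (hε2 : ε < 2) (hq : 0 < q)
    (hS : Summable (fun k : ℕ => (P ^ 2) ^ k * gaussianMoment ε q (2 * k + 1))) :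
    Summable (hornH4Term (2 - ε) ε (3 / 2) (1 + ε) (-P ^ 2 / (4 * q ^ 4)) (1 / 2)) ∧
    ∑' k : ℕ, (-P ^ 2) ^ k * gaussianMoment ε q (2 * k + 1) =
      q ^ (-4 + 2 * ε) * (2 * Gamma (2 - ε) / (ε * (8 * π) ^ (1 + ε))) *
        hornH4 (2 - ε) ε (3 / 2) (1 + ε) (-P ^ 2 / (4 * q ^ 4)) (1 / 2) := by
  set C := q ^ (-4 + 2 * ε) * (2 * Gamma (2 - ε) / (ε * (8 * π) ^ (1 + ε))) with hC
  have hG := Gamma_pos_of_pos (s := 2 - ε) (by linarith)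
  have hC0 : C ≠ 0 := by positivity
  have hσ : ∀ k : ℕ, 0 < ((2 * k + 1 : ℕ) : ℝ) + 1 - ε := by
    intro k
    push_cast
    have : (0 : ℝ) ≤ k := k.cast_nonneg
    linarith
  set c : ℕ → ℝ := fun k => (4 * π) ^ (-(1 + ε)) * Gamma ((2 * k + 1 : ℕ) + 1 - ε) *
        (q ^ 2) ^ (-((2 * k + 1 : ℕ) + 1 - ε)) / (2 * k + 1).factorial with hc
  have hc0 : ∀ k, 0 ≤ c k := by
    intro k
    have := Gamma_pos_of_pos (hσ k)
    simp only [hc]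
    positivity
  have hM : ∀ k, gaussianMoment ε q (2 * k + 1) =
      c k * ∑' n, betaCoeff ε ((2 * k + 1 : ℕ) + 1 - ε) n := fun k => rfl
  have hT : ∀ n k, C * hornH4Term (2 - ε) ε (3 / 2) (1 + ε) (-P ^ 2 / (4 * q ^ 4)) (1 / 2) (n, k) =
      (-P ^ 2) ^ k * (c k * betaCoeff ε ((2 * k + 1 : ℕ) + 1 - ε) n) := fun n k =>
    const_mul_hornH4Term hε hε2 hq P n k
  clear_value C c
  -- With P² in place of -P² all terms are nonnegative, so summability of the iterated sums gives
  -- that of the double series.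
  have habs : Summable fun kn : ℕ × ℕ =>
      (P ^ 2) ^ kn.1 * (c kn.1 * betaCoeff ε ((2 * kn.1 + 1 : ℕ) + 1 - ε) kn.2) := by
    have h0 : ∀ kn : ℕ × ℕ,
        0 ≤ (P ^ 2) ^ kn.1 * (c kn.1 * betaCoeff ε ((2 * kn.1 + 1 : ℕ) + 1 - ε) kn.2) := fun kn =>
      mul_nonneg (pow_nonneg (sq_nonneg P) _)
        (mul_nonneg (hc0 kn.1) (betaCoeff_nonneg hε (hσ kn.1) kn.2))
    refine (summable_prod_of_nonneg h0).2 ⟨fun k => ?_, ?_⟩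
    · simp only
      exact ((summable_betaCoeff hε (hσ k)).mul_left (c k)).mul_left ((P ^ 2) ^ k)
    · refine hS.congr fun k => ?_
      simp only
      rw [tsum_mul_left, tsum_mul_left, hM]
  have hsum : Summable fun kn : ℕ × ℕ =>
      (-P ^ 2) ^ kn.1 * (c kn.1 * betaCoeff ε ((2 * kn.1 + 1 : ℕ) + 1 - ε) kn.2) := by
    refine Summable.of_norm_bounded habs fun kn => le_of_eq ?_
    have h1 : 0 ≤ c kn.1 * betaCoeff ε ((2 * kn.1 + 1 : ℕ) + 1 - ε) kn.2 :=
      mul_nonneg (hc0 kn.1) (betaCoeff_nonneg hε (hσ kn.1) kn.2)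
    have h2 : ‖(-P ^ 2) ^ kn.1‖ = (P ^ 2) ^ kn.1 := by
      rw [norm_pow, norm_neg, Real.norm_of_nonneg (sq_nonneg P)]
    rw [norm_mul, h2, Real.norm_of_nonneg h1]
  have hsw : (fun nk : ℕ × ℕ => C *
        hornH4Term (2 - ε) ε (3 / 2) (1 + ε) (-P ^ 2 / (4 * q ^ 4)) (1 / 2) nk) =
      fun nk => (-P ^ 2) ^ nk.2 * (c nk.2 * betaCoeff ε ((2 * nk.2 + 1 : ℕ) + 1 - ε) nk.1) :=
    funext fun nk => hT nk.1 nk.2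
  have hsum' : Summable fun nk : ℕ × ℕ =>
      (-P ^ 2) ^ nk.2 * (c nk.2 * betaCoeff ε ((2 * nk.2 + 1 : ℕ) + 1 - ε) nk.1) :=
    hsum.prod_symm
  refine ⟨(summable_mul_left_iff hC0).1 (hsw ▸ hsum'), ?_⟩
  rw [hornH4, ← tsum_mul_left, hsw, hsum'.tsum_prod,
    Summable.tsum_comm
      (f := fun k n => (-P ^ 2) ^ k * (c k * betaCoeff ε ((2 * k + 1 : ℕ) + 1 - ε) n)) hsum]
  refine tsum_congr fun k => ?_
  rw [tsum_mul_left, tsum_mul_left, hM]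

end HornSeries

/-! ### Gaussian laws in integer and real dimension, and the final assembly. -/

section FeynmanIntegral

open MeasureTheory Real Set Filter Topology

/-- Complete the square: the exponent is centred at -Bv/(A + B), with remainder ‖v‖²AB/(A + B). -/
lemma integral_gaussian_pair {V : Type*} [NormedAddCommGroup V] [InnerProductSpace ℝ V]
    [FiniteDimensional ℝ V] [MeasurableSpace V] [BorelSpace V] (v : V) {A B : ℝ}
    (hA : 0 < A) (hB : 0 < B) :
    ∫ x : V, exp (-A * ‖x‖ ^ 2 - B * ‖x + v‖ ^ 2) =
      (π / (A + B)) ^ ((Module.finrank ℝ V : ℝ) / 2) *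
        exp (-(‖v‖ ^ 2 * (A * B) / (A + B))) := by
  have h := GaussianFourier.integral_rexp_neg_mul_sq_norm (V := V) (b := A + B) (by positivity)
  rw [← integral_add_right_eq_self _ ((B / (A + B)) • v)] at h
  rw [← h, ← integral_mul_const]
  refine integral_congr_ae (Eventually.of_forall fun x => ?_)
  simp only
  rw [← exp_add, norm_add_sq_real, norm_add_sq_real, norm_smul, inner_smul_right,
    Real.norm_of_nonneg (by positivity)]
  congr 1
  field_simp
  ring

lemma hasGaussianLaw_euclideanSpace (m : ℕ) (v : EuclideanSpace ℝ (Fin m)) {ε : ℝ}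
    (hε : ε = m / 2 - 1) :
    HasGaussianLaw (ENNReal.ofReal (1 / (2 * π) ^ m) • volume)
      (fun x : EuclideanSpace ℝ (Fin m) => ‖x‖ ^ 2) (fun x => ‖x + v‖ ^ 2) ε ‖v‖ := by
  intro A B hA hB
  have hm : 1 + ε = m / 2 := by linarith
  rw [lintegral_smul_measure, lintegral_ofReal_of_integral_eq
    (Eventually.of_forall fun x => (exp_pos _).le) (integral_gaussian_pair v hA hB) (by positivity),
    smul_eq_mul, ← ENNReal.ofReal_mul (by positivity), ← mul_assoc, hm]
  congr 2
  rw [finrank_euclideanSpace_fin, rpow_neg (by positivity), ← inv_rpow (by positivity),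
    ← rpow_natCast (2 * π) m, one_div, ← inv_rpow (by positivity)]
  have h2 : (m : ℝ) = 2 * (m / 2) := by ring
  rw [h2, rpow_mul (by positivity), mul_div_cancel_left₀ _ two_ne_zero, rpow_ofNat,
    ← mul_rpow (by positivity) (by positivity)]
  congr 1
  field_simp
  norm_num

lemma shiftedSq_eq (q r θ : ℝ) : shiftedSq q r θ = (r * cos θ + q) ^ 2 + (r * sin θ) ^ 2 := by
  rw [shiftedSq]
  linear_combination (-r ^ 2) * sin_sq_add_cos_sq θ

lemma lintegral_half_plane_gaussian {m C : ℝ} (hm : 1 < m) (hC : 0 < C) :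
    ∫⁻ y : ℝ, (Ioi (0 : ℝ)).indicator (fun y => ENNReal.ofReal (y ^ (m - 2) * exp (-C * y ^ 2))) y =
      ENNReal.ofReal (C ^ (-(m - 1) / 2) * (1 / 2) * Gamma ((m - 1) / 2)) := by
  have hG := Gamma_pos_of_pos (s := (m - 1) / 2) (by linarith)
  have h := integral_rpow_mul_exp_neg_mul_rpow (p := 2) (q := m - 2) two_pos (by linarith) hC
  have e : m - 2 + 1 = m - 1 := by ring
  simp_rw [rpow_ofNat, e] at h
  rw [lintegral_indicator measurableSet_Ioi]
  refine lintegral_ofReal_of_integral_eq ?_ h (by positivity)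
  filter_upwards [ae_restrict_mem measurableSet_Ioi] with y hy
  have : (0 : ℝ) < y := hy
  simp only [Pi.zero_apply]
  positivity

lemma lintegral_line_gaussian (q : ℝ) {A B : ℝ} (hA : 0 < A) (hB : 0 < B) :
    ∫⁻ x : ℝ, ENNReal.ofReal (exp (-A * x ^ 2 - B * (x + q) ^ 2)) =
      ENNReal.ofReal ((π / (A + B)) ^ (1 / 2 : ℝ) * exp (-(q ^ 2 * (A * B) / (A + B)))) := by
  have h := integral_gaussian_pair q hA hB
  simp only [Real.norm_eq_abs, sq_abs, Module.finrank_self, Nat.cast_one] at h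
  exact lintegral_ofReal_of_integral_eq (Eventually.of_forall fun x => (exp_pos _).le) h
    (by positivity)

/-- Polar angles range over (-π, π), and r sin θ > 0 selects exactly (0, π). -/
lemma lintegral_polar_upper_half_plane {f : ℝ × ℝ → ENNReal} :
    ∫⁻ z in Ioi (0 : ℝ) ×ˢ Ioo 0 π,
        ENNReal.ofReal z.1 * f (z.1 * cos z.2, z.1 * sin z.2) =
      ∫⁻ z : ℝ × ℝ, {z : ℝ × ℝ | 0 < z.2}.indicator f z := by
  rw [← lintegral_comp_polarCoord_symm, ← lintegral_indicator
    (measurableSet_Ioi.prod measurableSet_Ioo),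
    ← lintegral_indicator polarCoord.open_target.measurableSet]
  refine lintegral_congr fun ⟨r, θ⟩ => ?_
  by_cases ht : (r, θ) ∈ polarCoord.target
  · rw [indicator_of_mem ht]
    rw [polarCoord_target, mem_prod] at ht
    obtain ⟨hr, hθ⟩ := ht
    have hr' : 0 < r := hr
    by_cases h0 : 0 < θ
    · have hs : 0 < r * sin θ := mul_pos hr' (sin_pos_of_pos_of_lt_pi h0 hθ.2)
      rw [indicator_of_mem (show (r, θ) ∈ Ioi (0 : ℝ) ×ˢ Ioo 0 π from ⟨hr, h0, hθ.2⟩),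
        polarCoord_symm_apply, indicator_of_mem (by exact hs), smul_eq_mul]
    · have hs : ¬ 0 < r * sin θ := not_lt.2 (mul_nonpos_of_nonneg_of_nonpos hr'.le
        (sin_nonpos_of_nonpos_of_neg_pi_le (not_lt.1 h0) hθ.1.le))
      rw [indicator_of_notMem (fun h => h0 h.2.1), polarCoord_symm_apply,
        indicator_of_notMem (by exact hs), smul_zero]
  · rw [indicator_of_notMem ht, indicator_of_notMem]
    rintro ⟨hr, hθ⟩
    exact ht (by
      rw [polarCoord_target]
      exact ⟨hr, (neg_neg_of_pos pi_pos).trans hθ.1, hθ.2⟩)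

/-- The measure `K_m r^(m-1) sin^(m-2) θ / Ω_m dr dθ`, i.e. the pushforward of
`d^m x / (2π)^m` to the polar coordinates about an axis. -/
noncomputable def zonalMeasure (m : ℝ) : Measure (ℝ × ℝ) :=
  (volume.restrict (Ioi (0 : ℝ) ×ˢ Ioo 0 π)).withDensity fun z =>
    ENNReal.ofReal (sphereConst m / angularConst m * (z.1 ^ (m - 1) * sin z.2 ^ (m - 2)))

instance (m : ℝ) : SFinite (zonalMeasure m) := by
  unfold zonalMeasure
  infer_instance

lemma sphereConst_div_angularConst {m : ℝ} (hm : 1 < m) :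
    sphereConst m / angularConst m = 2 * (4 * π) ^ (-m / 2) / (√π * Gamma ((m - 1) / 2)) := by
  have h1 := Gamma_pos_of_pos (s := (m - 1) / 2) (by linarith)
  have h2 := Gamma_pos_of_pos (s := m / 2) (by linarith)
  have e : m / 2 - 1 / 2 = (m - 1) / 2 := by ring
  rw [sphereConst, angularConst, e]
  field_simp

lemma sphereConst_div_angularConst_pos {m : ℝ} (hm : 1 < m) :
    0 < sphereConst m / angularConst m := by
  have h1 := Gamma_pos_of_pos (s := (m - 1) / 2) (by linarith)
  rw [sphereConst_div_angularConst hm]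
  positivity

/-- In x = r cos θ, y = r sin θ the measure is a multiple of y^(m-2) dx dy on y > 0, and the
exponent separates into a Gaussian pair in x, along q, and (A + B)y², the radius in the m - 1
transverse dimensions. -/
lemma hasGaussianLaw_zonalMeasure {m ε : ℝ} (hm : 1 < m) (hε : ε = m / 2 - 1) (q : ℝ) :
    HasGaussianLaw (zonalMeasure m) (fun z => z.1 ^ 2) (fun z => shiftedSq q z.1 z.2) ε q := by
  intro A B hA hB
  have hκ := sphereConst_div_angularConst_pos hm
  have hG := Gamma_pos_of_pos (s := (m - 1) / 2) (by linarith)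
  set κ := sphereConst m / angularConst m with hκd
  set F : ℝ × ℝ → ENNReal := fun z =>
    ENNReal.ofReal (κ * (exp (-A * z.1 ^ 2 - B * (z.1 + q) ^ 2) *
      (z.2 ^ (m - 2) * exp (-(A + B) * z.2 ^ 2)))) with hF
  have hm1 : Measurable fun z : ℝ × ℝ =>
      ENNReal.ofReal (exp (-A * z.1 ^ 2 - B * shiftedSq q z.1 z.2)) := by
    unfold shiftedSq
    fun_prop
  rw [zonalMeasure, lintegral_withDensity_eq_lintegral_mul _ (by fun_prop) hm1]
  have e1 : ∀ z ∈ Ioi (0 : ℝ) ×ˢ Ioo 0 π,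
      ((fun z : ℝ × ℝ => ENNReal.ofReal (κ * (z.1 ^ (m - 1) * sin z.2 ^ (m - 2)))) *
        fun z : ℝ × ℝ => ENNReal.ofReal (exp (-A * z.1 ^ 2 - B * shiftedSq q z.1 z.2))) z =
      ENNReal.ofReal z.1 * F (z.1 * cos z.2, z.1 * sin z.2) := by
    rintro ⟨r, θ⟩ ⟨hr, hθ⟩
    have hr' : 0 < r := hr
    have hs : 0 < sin θ := sin_pos_of_pos_of_lt_pi hθ.1 hθ.2
    simp only [Pi.mul_apply, hF]
    rw [← ENNReal.ofReal_mul (by positivity), ← ENNReal.ofReal_mul (by positivity)]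
    congr 1
    -- One factor r is the polar Jacobian; the others combine with the sine into y^(m-2).
    have h1 : r ^ (m - 1) = r * r ^ (m - 2) := by
      rw [← rpow_one_add' hr'.le (by linarith)]
      congr 1
      ring
    have h2 : exp (-A * r ^ 2 - B * shiftedSq q r θ) =
        exp (-A * (r * cos θ) ^ 2 - B * (r * cos θ + q) ^ 2) *
          exp (-(A + B) * (r * sin θ) ^ 2) := by
      rw [← exp_add, shiftedSq_eq]
      congr 1
      linear_combination (A * r ^ 2) * sin_sq_add_cos_sq θ
    rw [h1, h2, mul_rpow hr'.le hs.le]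
    ring
  have e2 : ∀ z : ℝ × ℝ, {z : ℝ × ℝ | 0 < z.2}.indicator F z =
      ENNReal.ofReal κ * (ENNReal.ofReal (exp (-A * z.1 ^ 2 - B * (z.1 + q) ^ 2)) *
        (Ioi (0 : ℝ)).indicator
          (fun y => ENNReal.ofReal (y ^ (m - 2) * exp (-(A + B) * y ^ 2))) z.2) := by
    intro z
    by_cases hz : 0 < z.2
    · rw [indicator_of_mem (show z ∈ {z : ℝ × ℝ | 0 < z.2} from hz),
        indicator_of_mem (show z.2 ∈ Ioi (0 : ℝ) from hz), ← ENNReal.ofReal_mul (exp_pos _).le,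
        ← ENNReal.ofReal_mul hκ.le]
    · rw [indicator_of_notMem (show z ∉ {z : ℝ × ℝ | 0 < z.2} from hz),
        indicator_of_notMem (show z.2 ∉ Ioi (0 : ℝ) from hz), mul_zero, mul_zero]
  rw [setLIntegral_congr_fun (measurableSet_Ioi.prod measurableSet_Ioo) e1,
    lintegral_polar_upper_half_plane, lintegral_congr e2,
    lintegral_const_mul' _ _ ENNReal.ofReal_ne_top, Measure.volume_eq_prod,
    lintegral_prod_mul (f := fun x : ℝ => ENNReal.ofReal (exp (-A * x ^ 2 - B * (x + q) ^ 2)))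
      (g := (Ioi (0 : ℝ)).indicator
        fun y => ENNReal.ofReal (y ^ (m - 2) * exp (-(A + B) * y ^ 2))) (by fun_prop)
      ((by fun_prop : Measurable _).indicator measurableSet_Ioi).aemeasurable,
    lintegral_line_gaussian q hA hB, lintegral_half_plane_gaussian hm (by positivity),
    ← ENNReal.ofReal_mul (by positivity), ← ENNReal.ofReal_mul (by positivity)]
  congr 1
  have hm2 : -(1 + ε) = -m / 2 := by linarith
  have h3 : (A + B) ^ (-m / 2) = (A + B) ^ (-(1 / 2) : ℝ) * (A + B) ^ (-(m - 1) / 2) := by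
    rw [← rpow_add (by positivity)]
    congr 1
    ring
  rw [hκd, sphereConst_div_angularConst hm, hm2, mul_rpow (x := 4 * π) (by positivity) (by positivity),
    div_rpow (by positivity) (by positivity), h3, rpow_neg (x := A + B) (y := 1 / 2) (by positivity),
    sqrt_eq_rpow]
  field_simp

/-- By positivity and Tonelli, absolute convergence reduces to that of the weighted inner integral.
The weight w is the polar density in real dimension and 1 in integer dimension. -/
lemma integrable_prod_lifshitzPropagators_one {X : Type*} [MeasurableSpace X] {μ : Measure X}
    [SFinite μ] (p : EuclideanSpace ℝ (Fin 1)) {w a b : X → ℝ} (hw : Measurable w)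
    (ha : Measurable a) (hb : Measurable b) (hw0 : ∀ᵐ x ∂μ, 0 ≤ w x) (ha0 : ∀ᵐ x ∂μ, 0 < a x)
    (hb0 : ∀ᵐ x ∂μ, 0 < b x)
    (h : Integrable
      (fun x => w x * ((a x + b x) / (2 * a x * b x * ((a x + b x) ^ 2 + ‖p‖ ^ 2)))) μ) :
    Integrable (fun z : EuclideanSpace ℝ (Fin 1) × X =>
      w z.2 * lifshitzPropagators 1 p z.1 (a z.2) (b z.2)) (volume.prod μ) := by
  have hm : Measurable (fun z : EuclideanSpace ℝ (Fin 1) × X =>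
      w z.2 * lifshitzPropagators 1 p z.1 (a z.2) (b z.2)) := by
    unfold lifshitzPropagators
    fun_prop
  rw [integrable_prod_iff' hm.aestronglyMeasurable]
  constructor
  · filter_upwards [ha0, hb0] with x hax hbx
    exact (integrable_lifshitzPropagators_one p hax hbx).const_mul _
  · refine (h.const_mul (2 * π)).congr ?_
    filter_upwards [hw0, ha0, hb0] with x hwx hax hbx
    have h1 : ∀ y, ‖w x * lifshitzPropagators 1 p y (a x) (b x)‖ =
        w x * lifshitzPropagators 1 p y (a x) (b x) := fun y =>
      Real.norm_of_nonneg (mul_nonneg hwx (by unfold lifshitzPropagators; positivity))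
    simp_rw [h1]
    have : (a x + b x) ^ 2 + ‖p‖ ^ 2 ≠ 0 := by positivity
    rw [integral_const_mul, integral_lifshitzPropagators_one p hax hbx]
    field_simp

theorem lifshitz_of_real_dimension {m ε : ℝ} (hm2 : 2 < m) (hm6 : m < 6)
    (hε : ε = lifshitzEps 1 m) (p : EuclideanSpace ℝ (Fin 1)) {q : ℝ} (hq : 0 < q)
    (hpq : 4 * ‖p‖ ^ 2 / q ^ 4 < 1) :
    LifshitzConvergesReal 1 m p q ∧
      Summable (hornH4Term (2 - ε) ε (3 / 2) (1 + ε) (-‖p‖ ^ 2 / (4 * q ^ 4)) (1 / 2)) ∧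
      lifshitzIntegralReal 1 m p q =
        q ^ (-4 + 2 * ε) * (2 * Gamma (2 - ε) / (ε * (8 * π) ^ (1 + ε))) *
          hornH4 (2 - ε) ε (3 / 2) (1 + ε) (-‖p‖ ^ 2 / (4 * q ^ 4)) (1 / 2) := by
  have hε' : ε = m / 2 - 1 := by
    rw [hε, lifshitzEps]
    push_cast
    ring
  have hκ := sphereConst_div_angularConst_pos (m := m) (by linarith)
  set κ := sphereConst m / angularConst m with hκd
  set S : Set (ℝ × ℝ) := Ioi (0 : ℝ) ×ˢ Ioo 0 π with hS
  have hSm : MeasurableSet S := measurableSet_Ioi.prod measurableSet_Ioo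
  have hb : Measurable fun z : ℝ × ℝ => shiftedSq q z.1 z.2 := by
    unfold shiftedSq
    fun_prop
  have ha : Measurable fun z : ℝ × ℝ => z.1 ^ 2 := by fun_prop
  have hSpos : ∀ z ∈ S, 0 < z.1 ^ 2 ∧ 0 < shiftedSq q z.1 z.2 ∧
      0 ≤ z.1 ^ (m - 1) * sin z.2 ^ (m - 2) := by
    rintro ⟨r, θ⟩ ⟨hr, hθ⟩
    have hr' : 0 < r := hr
    have hs : 0 < sin θ := sin_pos_of_pos_of_lt_pi hθ.1 hθ.2
    refine ⟨by positivity, ?_, by positivity⟩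
    rw [shiftedSq_eq]
    positivity
  have hae : ∀ᵐ z ∂volume.restrict S, z ∈ S := ae_restrict_mem hSm
  have hac : zonalMeasure m ≪ volume.restrict S := withDensity_absolutelyContinuous _ _
  -- The right side is (2r + q cos θ)²/2 + q²(1 - cos² θ / 2).
  have hab : ∀ z : ℝ × ℝ, q ^ 2 / 2 ≤ z.1 ^ 2 + shiftedSq q z.1 z.2 := by
    intro z
    rw [shiftedSq]
    nlinarith [sq_nonneg (z.1 + q / 2 * cos z.2), sin_sq_add_cos_sq z.2, sq_nonneg (sin z.2),
      sq_nonneg (q * sin z.2), sq_nonneg (2 * z.1 + q * cos z.2)]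
  obtain ⟨hI, hs, hval⟩ := (hasGaussianLaw_zonalMeasure (by linarith) hε' q).integral_bubble ha hb
    (hac.ae_le (hae.mono fun z hz => (hSpos z hz).1))
    (hac.ae_le (hae.mono fun z hz => (hSpos z hz).2.1))
    (Eventually.of_forall hab) (by linarith) (by linarith) hq hpq
  obtain ⟨hsum, heq⟩ := summable_and_const_mul_hornH4 (by linarith) (by linarith) hq hs
  have hdm : Measurable fun z : ℝ × ℝ =>
      ENNReal.ofReal (κ * (z.1 ^ (m - 1) * sin z.2 ^ (m - 2))) := by fun_prop
  rw [zonalMeasure, integrable_withDensity_iff_integrable_smul' hdm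
    (Eventually.of_forall fun _ => ENNReal.ofReal_lt_top)] at hI
  rw [zonalMeasure, integral_withDensity_eq_integral_toReal_smul hdm
    (Eventually.of_forall fun _ => ENNReal.ofReal_lt_top)] at hval
  have hcongr : ∀ z ∈ S, (ENNReal.ofReal (κ * (z.1 ^ (m - 1) * sin z.2 ^ (m - 2)))).toReal •
        ((z.1 ^ 2 + shiftedSq q z.1 z.2) / (2 * z.1 ^ 2 * shiftedSq q z.1 z.2 *
          ((z.1 ^ 2 + shiftedSq q z.1 z.2) ^ 2 + ‖p‖ ^ 2))) =
      κ * (z.1 ^ (m - 1) * sin z.2 ^ (m - 2) *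
        lifshitzInner 1 p (z.1 ^ 2) (shiftedSq q z.1 z.2)) := by
    intro z hz
    obtain ⟨h1, h2, h3⟩ := hSpos z hz
    rw [ENNReal.toReal_ofReal (mul_nonneg hκ.le h3), lifshitzInner_one p h1 h2, smul_eq_mul,
      mul_assoc]
  have hI2 := hI.congr (hae.mono hcongr)
  rw [integral_congr_ae (hae.mono hcongr)] at hval
  have hprod : volume.restrict S =
      (volume.restrict (Ioi (0 : ℝ))).prod (volume.restrict (Ioo 0 π)) := by
    rw [Measure.prod_restrict, ← Measure.volume_eq_prod]
  refine ⟨?_, hsum, ?_⟩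
  · have hI3 := (hI2.const_mul κ⁻¹).congr (hae.mono fun z hz => by
      obtain ⟨h1, h2, h3⟩ := hSpos z hz
      exact inv_mul_cancel_left₀ hκ.ne' _ |>.trans
        (congrArg _ (lifshitzInner_one p h1 h2)))
    have h := integrable_prod_lifshitzPropagators_one p
      (w := fun z : ℝ × ℝ => z.1 ^ (m - 1) * sin z.2 ^ (m - 2)) (by fun_prop) ha hb
      (hae.mono fun z hz => (hSpos z hz).2.2) (hae.mono fun z hz => (hSpos z hz).1)
      (hae.mono fun z hz => (hSpos z hz).2.1) hI3
    rwa [← Measure.restrict_univ (μ := (volume : Measure (EuclideanSpace ℝ (Fin 1)))),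
      Measure.prod_restrict, ← Measure.volume_eq_prod] at h
  · rw [← heq, ← hval, lifshitzIntegralReal, hprod, integral_prod _ (hprod ▸ hI2),
      ← integral_const_mul]
    refine integral_congr_ae (Eventually.of_forall fun r => ?_)
    simp only
    rw [← integral_const_mul, ← integral_const_mul]
    refine integral_congr_ae (Eventually.of_forall fun θ => ?_)
    simp only [hκd]
    ring

theorem lifshitz_of_integer_dimension {m : ℕ} {ε : ℝ} (hm2 : 2 < m) (hm6 : m < 6)
    (hε : ε = lifshitzEps 1 m) (p : EuclideanSpace ℝ (Fin 1)) {q : EuclideanSpace ℝ (Fin m)}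
    (hq : q ≠ 0) (hpq : 4 * ‖p‖ ^ 2 / ‖q‖ ^ 4 < 1) :
    LifshitzConverges 1 m p q ∧
      lifshitzIntegral 1 m p q =
        ‖q‖ ^ (-4 + 2 * ε) * (2 * Gamma (2 - ε) / (ε * (8 * π) ^ (1 + ε))) *
          hornH4 (2 - ε) ε (3 / 2) (1 + ε) (-‖p‖ ^ 2 / (4 * ‖q‖ ^ 4)) (1 / 2) := by
  have hε' : ε = m / 2 - 1 := by
    rw [hε, lifshitzEps]
    push_cast
    ring
  have hm2' : (2 : ℝ) < m := by exact_mod_cast hm2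
  have hm6' : (m : ℝ) < 6 := by exact_mod_cast hm6
  -- Positive dimension makes Lebesgue measure atomless, so the singular points 0 and -q are null.
  have : NeZero m := ⟨by omega⟩
  have ha : Measurable fun x : EuclideanSpace ℝ (Fin m) => ‖x‖ ^ 2 := by fun_prop
  have hb : Measurable fun x : EuclideanSpace ℝ (Fin m) => ‖x + q‖ ^ 2 := by fun_prop
  have ha0 : ∀ᵐ x : EuclideanSpace ℝ (Fin m), 0 < ‖x‖ ^ 2 := by
    filter_upwards [Measure.ae_ne volume 0] with x hx
    positivity
  have hb0 : ∀ᵐ x : EuclideanSpace ℝ (Fin m), 0 < ‖x + q‖ ^ 2 := by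
    filter_upwards [Measure.ae_ne volume (-q)] with x hx
    have : x + q ≠ 0 := fun h => hx (eq_neg_of_add_eq_zero_left h)
    positivity
  have hab : ∀ x : EuclideanSpace ℝ (Fin m), ‖q‖ ^ 2 / 2 ≤ ‖x‖ ^ 2 + ‖x + q‖ ^ 2 := by
    intro x
    have h1 : ‖q‖ ≤ ‖x‖ + ‖x + q‖ := by
      have := norm_sub_le (x + q) x
      rw [add_sub_cancel_left] at this
      linarith
    nlinarith [pow_le_pow_left₀ (norm_nonneg q) h1 2, sq_nonneg (‖x‖ - ‖x + q‖)]
  have hc0 : ENNReal.ofReal (1 / (2 * π) ^ m) ≠ 0 := by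
    rw [Ne, ENNReal.ofReal_eq_zero, not_le]
    positivity
  have hq0 : 0 < ‖q‖ := norm_pos_iff.2 hq
  obtain ⟨hI, hs, hval⟩ := (hasGaussianLaw_euclideanSpace m q hε').integral_bubble ha hb
    (Measure.ae_smul_measure ha0 _) (Measure.ae_smul_measure hb0 _)
    (Eventually.of_forall hab) (by linarith) (by linarith) hq0 hpq
  obtain ⟨-, heq⟩ := summable_and_const_mul_hornH4 (by linarith) (by linarith) hq0 hs
  rw [integrable_smul_measure hc0 ENNReal.ofReal_ne_top] at hI
  constructor
  · have h := integrable_prod_lifshitzPropagators_one p (w := fun _ => 1) measurable_const ha hb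
      (Eventually.of_forall fun _ => zero_le_one) ha0 hb0 (by simpa only [one_mul] using hI)
    simp only [one_mul] at h
    exact h
  · rw [← heq, ← hval, integral_smul_measure, ENNReal.toReal_ofReal (by positivity),
      lifshitzIntegral, integral_div, smul_eq_mul, one_div_mul_eq_div]
    congr 1
    refine integral_congr_ae ?_
    filter_upwards [ha0, hb0] with x hax hbx
    exact lifshitzInner_one p hax hbx

end FeynmanIntegral

theorem theorem8 :
    -- all real dimensions `2 < m < 6`
    (∀ m ε : ℝ, 2 < m → m < 6 → ε = lifshitzEps 1 m →
      ∀ (p : EuclideanSpace ℝ (Fin 1)) (q : ℝ), 0 < q → 4 * ‖p‖ ^ 2 / q ^ 4 < 1 →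
      LifshitzConvergesReal 1 m p q ∧
      Summable (hornH4Term (2 - ε) ε (3 / 2) (1 + ε) (-‖p‖ ^ 2 / (4 * q ^ 4)) (1 / 2)) ∧
      lifshitzIntegralReal 1 m p q =
        q ^ (-4 + 2 * ε) * (2 * Real.Gamma (2 - ε) / (ε * (8 * Real.pi) ^ (1 + ε))) *
          hornH4 (2 - ε) ε (3 / 2) (1 + ε) (-‖p‖ ^ 2 / (4 * q ^ 4)) (1 / 2)) ∧
    -- integer dimensions `2 < m < 6`, for the integral over `ℝ ⊕ ℝ^m` itself
    (∀ (m : ℕ) (ε : ℝ), 2 < m → m < 6 → ε = lifshitzEps 1 m →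
      ∀ (p : EuclideanSpace ℝ (Fin 1)) (q : EuclideanSpace ℝ (Fin m)), q ≠ 0 →
      4 * ‖p‖ ^ 2 / ‖q‖ ^ 4 < 1 →
      LifshitzConverges 1 m p q ∧
      lifshitzIntegral 1 m p q =
        ‖q‖ ^ (-4 + 2 * ε) * (2 * Real.Gamma (2 - ε) / (ε * (8 * Real.pi) ^ (1 + ε))) *
          hornH4 (2 - ε) ε (3 / 2) (1 + ε) (-‖p‖ ^ 2 / (4 * ‖q‖ ^ 4)) (1 / 2)) :=
  ⟨fun _ _ h2 h6 hε p _ hq hpq => lifshitz_of_real_dimension h2 h6 hε p hq hpq,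
    fun _ _ h2 h6 hε p _ hq hpq => lifshitz_of_integer_dimension h2 h6 hε p hq hpq⟩
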